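/- Let $B_{1,n}$ ($n\ge 1$) be the Artin braid group of type B, with generators $t,\sigma_1,\dots,\sigma_{n-1}$ and relations $\sigma_1t\sigma_1t=t\sigma_1t\sigma_1$, $t\sigma_i=\sigma_it$ ($i>1$), $\sigma_i\sigma_{i+1}\sigma_i=\sigma_{i+1}\sigma_i\sigma_{i+1}$, $\sigma_i\sigma_j=\sigma_j\sigma_i$ ($|i-j|>1$). Let $\mathrm H_{1,n}(q)$ be the quotient of the group algebra $\mathbb C[q^{\pm1}]B_{1,n}$ by the relations $g_i^2=(q-1)g_i+q$, where $g_i$ is the image of $\sigma_i$, and let $\mathcal H=\bigcup_{n\ge1}\mathrm H_{1,n}(q)$. Put $t_1=g_1tg_1$ and $t_n'=g_n\cdots g_1\,t\,g_1^{-1}\cdots g_n^{-1}$. Let $A$ be a commutative $\mathbb C[q^{\pm1}]$-algebra, $z\in A$ and $s_k\in A$ ($k\in\mathbb Z$), and let $\mathrm{tr}:\mathcal H\to A$ be a Markov trace with parameters $z,s_k$, that is, a $\mathbb C[q^{\pm1}]$-linear map such that, for all $n\ge1$, $$\mathrm{tr}(ab)=\mathrm{tr}(ba)\ \ (a,b\in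 \mathrm H_{1,n}(q)),\qquad \mathrm{tr}(1)=1,$$ $$\mathrm{tr}(a g_n)=z\,\mathrm{tr}(a),\qquad \mathrm{tr}\bigl(a(t_n')^k\bigr)=s_k\,\mathrm{tr}(a)\ \ (a\in \mathrm H_{1,n}(q),\ k\in\mathbb Z).$$ **Lemma.** There are polynomials $f_{k,j}\in\mathbb Z[q,z]$ ($0\le j\le k$), depending only on $k$ and $j$, such that for every such $A$, $z$, $(s_k)$ and $\mathrm{tr}$, and for every $p\in\mathbb Z$, the following relations hold. (i) For every integer $k\ge 0$, $$\mathrm{tr}(t^pt_1^kg_1)=q^kz\,s_{p+k}+\sum_{j=0}^{k-1}q^j(q-1)\,\mathrm{tr}(t^{p+j}t_1^{k-j}).$$ (ii) For every integer $k\ge 1$, $$\mathrm{tr}(t^pt_1^kg_1^{-1})=q^{k-1}z\,s_{p+k}+\sum_{j=0}^{k-2}q^j(q-1)\,\mathrm{tr}(t^{p+1+j}t_1^{k-1-j}).$$ (iii) For every integer $k\ge 1$, $$\mathrm{tr}(t^pt_1^kg_1)=(q^2-q+1)\,\mathrm{tr}(t^{p+1}t_1^{k-1}g_1)+q^k(q-1)\,s_ks_p+\sum_{j=2}^{k}q^{j-1}(q-1)^2\,\mathrm{tr}(t^{p+j}t_1^{k-j}g_1).$$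 (iv) For every integer $k\ge 0$, $$\mathrm{tr}(t^pt_1^k)=\sum_{j=0}^{k}f_{k,j}(q,z)\,s_{p+k-j}\,s_j.$$ -/

import Mathlib

noncomputable section

namespace TypeB

/-- The ground ring `ℂ[q, q⁻¹]`. -/
abbrev Rq : Type := LaurentPolynomial ℂ

/-- The variable `q` of `ℂ[q, q⁻¹]`. -/
def qv : Rq := LaurentPolynomial.T 1

/-- The generators `t, σ_1, …, σ_{n-1}` of the Artin braid group of type B with `n` moving
strands. -/
inductive Gen (n : ℕ) : Type
  | t : Gen n
  | σ (i : ℕ) (h₁ : 1 ≤ i) (h₂ : i < n) : Gen n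

/-- The relators of `B_{1,n}`; a relation `u = v` is recorded as the word `u * v⁻¹`. -/
inductive IsRelator (n : ℕ) : FreeGroup (Gen n) → Prop
  /-- `σ_1 t σ_1 t = t σ_1 t σ_1` -/
  | four (h₁ : 1 ≤ 1) (h₂ : 1 < n) :
      IsRelator n
        ((FreeGroup.of (Gen.σ 1 h₁ h₂) * FreeGroup.of Gen.t *
            FreeGroup.of (Gen.σ 1 h₁ h₂) * FreeGroup.of Gen.t) *
          (FreeGroup.of Gen.t * FreeGroup.of (Gen.σ 1 h₁ h₂) *
            FreeGroup.of Gen.t * FreeGroup.of (Gen.σ 1 h₁ h₂))⁻¹)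
  /-- `t σ_i = σ_i t` for `i > 1` -/
  | comm_t (i : ℕ) (h₁ : 1 ≤ i) (h₂ : i < n) (hi : 1 < i) :
      IsRelator n
        ((FreeGroup.of Gen.t * FreeGroup.of (Gen.σ i h₁ h₂)) *
          (FreeGroup.of (Gen.σ i h₁ h₂) * FreeGroup.of Gen.t)⁻¹)
  /-- `σ_i σ_{i+1} σ_i = σ_{i+1} σ_i σ_{i+1}` -/
  | braid (i : ℕ) (h₁ : 1 ≤ i) (h₂ : i < n) (h₁' : 1 ≤ i + 1) (h₂' : i + 1 < n) :
      IsRelator n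
        ((FreeGroup.of (Gen.σ i h₁ h₂) * FreeGroup.of (Gen.σ (i + 1) h₁' h₂') *
            FreeGroup.of (Gen.σ i h₁ h₂)) *
          (FreeGroup.of (Gen.σ (i + 1) h₁' h₂') * FreeGroup.of (Gen.σ i h₁ h₂) *
            FreeGroup.of (Gen.σ (i + 1) h₁' h₂'))⁻¹)
  /-- `σ_i σ_j = σ_j σ_i` for `|i - j| > 1` -/
  | comm (i j : ℕ) (h₁ : 1 ≤ i) (h₂ : i < n) (h₁' : 1 ≤ j) (h₂' : j < n) (hij : i + 1 < j) :
      IsRelator n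
        ((FreeGroup.of (Gen.σ i h₁ h₂) * FreeGroup.of (Gen.σ j h₁' h₂')) *
          (FreeGroup.of (Gen.σ j h₁' h₂') * FreeGroup.of (Gen.σ i h₁ h₂))⁻¹)

/-- The Artin braid group of type B, `B_{1,n}` (meaningful for `n ≥ 1`). -/
abbrev Braid (n : ℕ) : Type := PresentedGroup {r : FreeGroup (Gen n) | IsRelator n r}

namespace Braid

/-- The generator `t` of `B_{1,n}`. -/
def t (n : ℕ) : Braid n := PresentedGroup.of Gen.t

/-- The generator `σ_i` of `B_{1,n}`, `1 ≤ i ≤ n - 1`. -/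
def σ {n : ℕ} (i : ℕ) (h₁ : 1 ≤ i) (h₂ : i < n) : Braid n := PresentedGroup.of (Gen.σ i h₁ h₂)

/-- `t_i = σ_i ⋯ σ_1 t σ_1 ⋯ σ_i` in `B_{1,n}`, `0 ≤ i ≤ n - 1`. -/
def loop {n : ℕ} : (i : ℕ) → i < n → Braid n
  | 0, _ => t n
  | i + 1, h => σ (i + 1) (Nat.succ_pos i) h * loop i (Nat.lt_of_succ_lt h) *
      σ (i + 1) (Nat.succ_pos i) h

/-- `t'_i = σ_i ⋯ σ_1 t σ_1⁻¹ ⋯ σ_i⁻¹` in `B_{1,n}`, `0 ≤ i ≤ n - 1`. -/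
def loop' {n : ℕ} : (i : ℕ) → i < n → Braid n
  | 0, _ => t n
  | i + 1, h => σ (i + 1) (Nat.succ_pos i) h * loop' i (Nat.lt_of_succ_lt h) *
      (σ (i + 1) (Nat.succ_pos i) h)⁻¹

/-- The standard map on generators for `B_{1,n} → B_{1,n+1}`. -/
def inclGen (n : ℕ) : Gen n → Braid (n + 1)
  | Gen.t => t (n + 1)
  | Gen.σ i h₁ h₂ => σ i h₁ (Nat.lt_succ_of_lt h₂)

theorem inclGen_rel (n : ℕ) :
    ∀ r ∈ {r : FreeGroup (Gen n) | IsRelator n r}, FreeGroup.lift (inclGen n) r = 1 := by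
  have key : ∀ r, IsRelator (n + 1) r →
      PresentedGroup.mk {r : FreeGroup (Gen (n + 1)) | IsRelator (n + 1) r} r = 1 :=
    fun r hr => PresentedGroup.one_of_mem hr
  rintro r hr
  cases hr with
  | four h₁ h₂ => simpa [inclGen, t, σ, PresentedGroup.of] using key _ (.four h₁ (Nat.lt_succ_of_lt h₂))
  | comm_t i h₁ h₂ hi => simpa [inclGen, t, σ, PresentedGroup.of] using key _ (.comm_t i h₁ (Nat.lt_succ_of_lt h₂) hi)
  | braid i h₁ h₂ h₁' h₂' =>
    simpa [inclGen, t, σ, PresentedGroup.of] using key _ (.braid i h₁ (Nat.lt_succ_of_lt h₂) h₁' (Nat.lt_succ_of_lt h₂'))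
  | comm i j h₁ h₂ h₁' h₂' hij =>
    simpa [inclGen, t, σ, PresentedGroup.of] using key _
      (.comm i j h₁ (Nat.lt_succ_of_lt h₂) h₁' (Nat.lt_succ_of_lt h₂') hij)

/-- The standard homomorphism `B_{1,n} → B_{1,n+1}` that adds one strand on the right. -/
def incl (n : ℕ) : Braid n →* Braid (n + 1) := PresentedGroup.toGroup (inclGen_rel n)

theorem incl_σ {n : ℕ} (i : ℕ) (h₁ : 1 ≤ i) (h₂ : i < n) :
    incl n (σ i h₁ h₂) = σ i h₁ (Nat.lt_succ_of_lt h₂) :=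
  PresentedGroup.toGroup.of (inclGen_rel n)

theorem incl_t (n : ℕ) : incl n (t n) = t (n + 1) :=
  PresentedGroup.toGroup.of (inclGen_rel n)

end Braid

/-- The quadratic relations `σ_i² = (q - 1) σ_i + q` in the group algebra `ℂ[q, q⁻¹] B_{1,n}`. -/
inductive QuadRel (n : ℕ) :
    MonoidAlgebra Rq (Braid n) → MonoidAlgebra Rq (Braid n) → Prop
  | quad (i : ℕ) (h₁ : 1 ≤ i) (h₂ : i < n) :
      QuadRel n (MonoidAlgebra.of Rq (Braid n) (Braid.σ i h₁ h₂) ^ 2)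
        ((qv - 1) • MonoidAlgebra.of Rq (Braid n) (Braid.σ i h₁ h₂) + qv • 1)

/-- The generalized Iwahori–Hecke algebra of type B, `H_{1,n}(q)`: the group algebra
`ℂ[q, q⁻¹] B_{1,n}` modulo the two-sided ideal generated by the quadratic relations. -/
abbrev Hecke (n : ℕ) : Type := RingQuot (QuadRel n)

/-- The canonical map `π : B_{1,n} → H_{1,n}(q)`, with `t ↦ t` and `σ_i ↦ g_i`. -/
def toHecke (n : ℕ) : Braid n →* Hecke n :=
  ((RingQuot.mkAlgHom Rq (QuadRel n) : MonoidAlgebra Rq (Braid n) →* Hecke n)).comp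
    (MonoidAlgebra.of Rq (Braid n))

theorem toHecke_quad {n : ℕ} (i : ℕ) (h₁ : 1 ≤ i) (h₂ : i < n) :
    toHecke n (Braid.σ i h₁ h₂) ^ 2 = (qv - 1) • toHecke n (Braid.σ i h₁ h₂) + qv • 1 := by
  have h := RingQuot.mkAlgHom_rel Rq (QuadRel.quad (n := n) i h₁ h₂)
  rw [map_pow, map_add, map_smul, map_smul, map_one] at h
  exact h

theorem inclHecke_rel (n : ℕ) ⦃x y : MonoidAlgebra Rq (Braid n)⦄ (h : QuadRel n x y) :
    MonoidAlgebra.lift Rq (Hecke (n + 1)) (Braid n) ((toHecke (n + 1)).comp (Braid.incl n)) x =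
      MonoidAlgebra.lift Rq (Hecke (n + 1)) (Braid n)
        ((toHecke (n + 1)).comp (Braid.incl n)) y := by
  cases h with
  | quad i h₁ h₂ =>
    simp only [map_pow, map_add, map_smul, map_one, MonoidAlgebra.lift_of, MonoidHom.comp_apply,
      Braid.incl_σ]
    exact toHecke_quad i h₁ (Nat.lt_succ_of_lt h₂)

/-- The homomorphism `H_{1,n}(q) → H_{1,n+1}(q)` induced by `B_{1,n} → B_{1,n+1}`; the union
`⋃ H_{1,n}(q)` is formed along these maps. -/
def inclHecke (n : ℕ) : Hecke n →ₐ[Rq] Hecke (n + 1) :=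
  RingQuot.liftAlgHom Rq
    ⟨MonoidAlgebra.lift Rq (Hecke (n + 1)) (Braid n) ((toHecke (n + 1)).comp (Braid.incl n)),
      inclHecke_rel n⟩

/-- `tr` is a Markov trace on `⋃_{n ≥ 1} H_{1,n}(q)` with parameters `z` and `s_k`, `k ∈ ℤ`, in a
commutative `ℂ[q, q⁻¹]`-algebra `A`. A linear map on the union is given by its restrictions
`tr n` to the `H_{1,n}(q)`, which are compatible with the maps `H_{1,n}(q) → H_{1,n+1}(q)`. -/
structure IsMarkovTrace {A : Type*} [CommRing A] [Algebra Rq A] (z : A) (s : ℤ → A)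
    (tr : (n : ℕ) → Hecke n →ₗ[Rq] A) : Prop where
  compat : ∀ n, 1 ≤ n → ∀ a : Hecke n, tr (n + 1) (inclHecke n a) = tr n a
  /-- `tr(ab) = tr(ba)` -/
  mul_comm : ∀ n, 1 ≤ n → ∀ a b : Hecke n, tr n (a * b) = tr n (b * a)
  /-- `tr(1) = 1` -/
  one : ∀ n, 1 ≤ n → tr n 1 = 1
  /-- `tr(a g_n) = z tr(a)` for `a ∈ H_{1,n}(q)` -/
  mul_g : ∀ (n : ℕ) (hn : 1 ≤ n) (a : Hecke n),
    tr (n + 1) (inclHecke n a * toHecke (n + 1) (Braid.σ n hn (Nat.lt_succ_self n))) = z * tr n a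
  /-- `tr(a (t'_n)^k) = s_k tr(a)` for `a ∈ H_{1,n}(q)`, `k ∈ ℤ` -/
  mul_loop' : ∀ n, 1 ≤ n → ∀ (a : Hecke n) (k : ℤ),
    tr (n + 1) (inclHecke n a * toHecke (n + 1) (Braid.loop' n (Nat.lt_succ_self n) ^ k)) =
      s k * tr n a

/-- `tr(x)` for the image `x ∈ H_{1,2}(q)` of a braid with two moving strands. -/
def trBraid {A : Type*} [CommRing A] [Algebra Rq A] (tr : (n : ℕ) → Hecke n →ₗ[Rq] A)
    (b : Braid 2) : A :=
  tr 2 (toHecke 2 b)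

/-- `σ_1 ∈ B_{1,2}`, whose image in `H_{1,2}(q)` is `g_1`. -/
abbrev g₁ : Braid 2 := Braid.σ 1 (le_refl 1) Nat.one_lt_two

/-- `t ∈ B_{1,2}`. -/
abbrev t₀ : Braid 2 := Braid.t 2

/-- `t_1 = σ_1 t σ_1 ∈ B_{1,2}`. -/
abbrev t₁ : Braid 2 := Braid.loop 1 Nat.one_lt_two

end TypeB

end

namespace TypeB

/-! Write G(p,k) for the trace of t^p t_1^k g_1 and E(p,k) for that of t^p t_1^k. Three facts drive
everything: t and t_1 commute, t_1 g_1⁻¹ = g_1 t, and g_1 = (q-1) + q g_1⁻¹. With cyclicity they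
give G(p,k+1) = q G(p+1,k) + (q-1) E(p,k+1) (`trBraid_g_succ`). Iterating down to G(p+k,0) = z
s_{p+k} yields (i), and `trBraid_inv_g` reduces (ii) to (i). Inserting 1 = g_1 g_1⁻¹ after t_1^k and
feeding the factors t_1 one by one into the conjugate g_1 t^m g_1⁻¹ expresses E by q^k s_k s_p and
values of G (`trBraid_conj`). Substituting this into the recursion gives (iii), and running both
recursions on coefficients gives (iv). -/

/-- The type B relation in `B_{1,2}`: `t` and `t_1` commute. -/
theorem commute_t₀_t₁ : Commute t₀ t₁ := by
  have h := PresentedGroup.one_of_mem (rels := {r : FreeGroup (Gen 2) | IsRelator 2 r})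
    (IsRelator.four (le_refl 1) Nat.one_lt_two)
  have h' : g₁ * t₀ * g₁ * t₀ * (t₀ * g₁ * t₀ * g₁)⁻¹ = 1 := by
    simpa [Braid.σ, Braid.t, PresentedGroup.of] using h
  have h'' := mul_inv_eq_one.mp h'
  change t₀ * (g₁ * t₀ * g₁) = g₁ * t₀ * g₁ * t₀
  rw [h'']
  group

theorem t₁_mul_inv_g₁ : t₁ * g₁⁻¹ = g₁ * t₀ := by
  change g₁ * t₀ * g₁ * g₁⁻¹ = g₁ * t₀
  group

theorem inclHecke_toHecke (n : ℕ) (b : Braid n) :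
    inclHecke n (toHecke n b) = toHecke (n + 1) (Braid.incl n b) := by
  simp [inclHecke, toHecke]

/-- The quadratic relation in the form `g_1 = (q - 1) + q g_1⁻¹`. -/
theorem toHecke_g₁ : toHecke 2 g₁ = (qv - 1) • 1 + qv • toHecke 2 g₁⁻¹ := by
  have h := congrArg (· * toHecke 2 g₁⁻¹) (toHecke_quad (n := 2) 1 (le_refl 1) Nat.one_lt_two)
  have hinv : toHecke 2 g₁ * toHecke 2 g₁⁻¹ = 1 := by rw [← map_mul, mul_inv_cancel, map_one]
  simp only [sq, add_mul, smul_mul_assoc, one_mul] at h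
  rw [mul_assoc, hinv, mul_one] at h
  exact h

/-! ### Trace identities in two moving strands. -/

namespace IsMarkovTrace

variable {A : Type*} [CommRing A] [Algebra Rq A] {z : A} {s : ℤ → A}
  {tr : (n : ℕ) → Hecke n →ₗ[Rq] A}

theorem trBraid_mul_comm (h : IsMarkovTrace z s tr) (a b : Braid 2) :
    trBraid tr (a * b) = trBraid tr (b * a) := by
  simp only [trBraid, map_mul]
  exact h.mul_comm 2 one_le_two _ _

/-- The skein relation for the trace. -/
theorem trBraid_skein (tr : (n : ℕ) → Hecke n →ₗ[Rq] A) (a b : Braid 2) :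
    trBraid tr (a * g₁ * b) = (algebraMap Rq A qv - 1) * trBraid tr (a * b) +
      algebraMap Rq A qv * trBraid tr (a * g₁⁻¹ * b) := by
  simp only [trBraid, map_mul]
  rw [toHecke_g₁]
  simp only [mul_add, add_mul, mul_smul_comm, smul_mul_assoc, mul_one, map_add, map_smul]
  simp only [Algebra.smul_def, map_sub, map_one]

theorem s_zero (h : IsMarkovTrace z s tr) : s 0 = 1 := by
  have := h.mul_loop' 1 le_rfl 1 0
  simpa [h.one] using this.symm

theorem trBraid_loop' (h : IsMarkovTrace z s tr) (b : Braid 1) (m : ℤ) :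
    trBraid tr (Braid.incl 1 b * (g₁ * t₀ ^ m * g₁⁻¹)) = s m * tr 1 (toHecke 1 b) := by
  have := h.mul_loop' 1 le_rfl (toHecke 1 b) m
  rw [inclHecke_toHecke, ← map_mul] at this
  rw [← this, ← conj_zpow]
  rfl

/-- The axioms prescribe loops t'_n only for n ≥ 1. In two strands t'_1 is conjugate to t, so
cyclicity carries the value over, and compatibility brings it down to one strand. -/
theorem tr_one_t_zpow (h : IsMarkovTrace z s tr) (p : ℤ) :
    tr 1 (toHecke 1 (Braid.t 1 ^ p)) = s p := by
  have h₁ := h.trBraid_loop' 1 p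
  rw [map_one, one_mul, h.trBraid_mul_comm, map_one, h.one 1 le_rfl, mul_one, ← mul_assoc,
    inv_mul_cancel, one_mul] at h₁
  rw [← h₁, ← h.compat 1 le_rfl, inclHecke_toHecke, map_zpow, Braid.incl_t]
  rfl

theorem trBraid_t_conj (h : IsMarkovTrace z s tr) (p m : ℤ) :
    trBraid tr (t₀ ^ p * (g₁ * t₀ ^ m * g₁⁻¹)) = s m * s p := by
  have := h.trBraid_loop' (Braid.t 1 ^ p) m
  rwa [map_zpow, Braid.incl_t, h.tr_one_t_zpow] at this

theorem trBraid_t_g (h : IsMarkovTrace z s tr) (p : ℤ) :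
    trBraid tr (t₀ ^ p * g₁) = z * s p := by
  have := h.mul_g 1 le_rfl (toHecke 1 (Braid.t 1 ^ p))
  rw [inclHecke_toHecke, ← map_mul, map_zpow, Braid.incl_t, h.tr_one_t_zpow] at this
  exact this

/-- Cancelling `g_1⁻¹` against the last factor `t_1`. -/
theorem trBraid_inv_g (h : IsMarkovTrace z s tr) (p : ℤ) (k : ℕ) :
    trBraid tr (t₀ ^ p * t₁ ^ (k + 1) * g₁⁻¹) = trBraid tr (t₀ ^ (p + 1) * t₁ ^ k * g₁) := by
  have e : t₀ ^ p * t₁ ^ (k + 1) * g₁⁻¹ = (t₀ ^ p * t₁ ^ k * g₁) * t₀ := by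
    rw [pow_succ, ← mul_assoc, mul_assoc _ t₁, t₁_mul_inv_g₁, ← mul_assoc]
  rw [e, h.trBraid_mul_comm, add_comm p 1, zpow_add, zpow_one]
  simp only [mul_assoc]

theorem trBraid_g_succ (h : IsMarkovTrace z s tr) (p : ℤ) (k : ℕ) :
    trBraid tr (t₀ ^ p * t₁ ^ (k + 1) * g₁) =
      algebraMap Rq A qv * trBraid tr (t₀ ^ (p + 1) * t₁ ^ k * g₁) +
        (algebraMap Rq A qv - 1) * trBraid tr (t₀ ^ p * t₁ ^ (k + 1)) := by
  have := trBraid_skein tr (t₀ ^ p * t₁ ^ (k + 1)) 1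
  simp only [mul_one] at this
  rw [this, h.trBraid_inv_g, add_comm]

/-- The skein relation is applied to the g_1 opening the conjugate. In the g_1⁻¹ branch, t_1 g_1⁻¹ =
g_1 t raises the conjugated exponent; in the other branch t^m moves left past t_1^(k+1). -/
theorem trBraid_conj_succ (h : IsMarkovTrace z s tr) (p : ℤ) (k m : ℕ) :
    trBraid tr (t₀ ^ p * t₁ ^ (k + 1) * (g₁ * t₀ ^ m * g₁⁻¹)) =
      algebraMap Rq A qv * trBraid tr (t₀ ^ p * t₁ ^ k * (g₁ * t₀ ^ (m + 1) * g₁⁻¹)) +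
        (algebraMap Rq A qv - 1) * trBraid tr (t₀ ^ (p + m + 1) * t₁ ^ k * g₁) := by
  have e₁ : t₀ ^ p * t₁ ^ (k + 1) * (g₁ * t₀ ^ m * g₁⁻¹) =
      (t₀ ^ p * t₁ ^ (k + 1)) * g₁ * (t₀ ^ m * g₁⁻¹) := by simp only [mul_assoc]
  have e₂ : (t₀ ^ p * t₁ ^ (k + 1)) * (t₀ ^ m * g₁⁻¹) =
      t₀ ^ (p + m) * t₁ ^ (k + 1) * g₁⁻¹ := by
    rw [zpow_add, zpow_natCast, mul_assoc, ← mul_assoc (t₁ ^ (k + 1)),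
      ← (commute_t₀_t₁.pow_pow m (k + 1)).eq]
    simp only [mul_assoc]
  have e₃ : (t₀ ^ p * t₁ ^ (k + 1)) * g₁⁻¹ * (t₀ ^ m * g₁⁻¹) =
      t₀ ^ p * t₁ ^ k * (g₁ * t₀ ^ (m + 1) * g₁⁻¹) := by
    rw [pow_succ t₁, ← mul_assoc (t₀ ^ p), mul_assoc _ t₁, t₁_mul_inv_g₁, pow_succ' t₀]
    simp only [mul_assoc]
  rw [e₁, trBraid_skein, e₂, e₃, h.trBraid_inv_g, add_comm]

/-- Only m = 0 is used later, where the conjugate is trivial; general m is what the induction needs,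
since each step raises it. -/
theorem trBraid_conj (h : IsMarkovTrace z s tr) (k : ℕ) : ∀ (p : ℤ) (m : ℕ),
    trBraid tr (t₀ ^ p * t₁ ^ k * (g₁ * t₀ ^ m * g₁⁻¹)) =
      algebraMap Rq A qv ^ k * s (m + k) * s p + (algebraMap Rq A qv - 1) *
        ∑ j ∈ Finset.range k, algebraMap Rq A qv ^ j *
          trBraid tr (t₀ ^ (p + m + 1 + j) * t₁ ^ (k - 1 - j) * g₁) := by
  induction k with
  | zero =>
    intro p m
    have := h.trBraid_t_conj p m
    simpa using this
  | succ k ih =>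
    intro p m
    rw [h.trBraid_conj_succ, ih, Finset.sum_range_succ']
    have e : ∀ j : ℕ, algebraMap Rq A qv ^ (j + 1) *
        trBraid tr (t₀ ^ (p + m + 1 + (j + 1 : ℕ)) * t₁ ^ (k + 1 - 1 - (j + 1)) * g₁) =
        algebraMap Rq A qv * (algebraMap Rq A qv ^ j *
          trBraid tr (t₀ ^ (p + (m + 1 : ℕ) + 1 + j) * t₁ ^ (k - 1 - j) * g₁)) := by
      intro j
      rw [show p + m + 1 + ((j + 1 : ℕ) : ℤ) = p + (m + 1 : ℕ) + 1 + j by push_cast; ring,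
        show k + 1 - 1 - (j + 1) = k - 1 - j by omega, pow_succ]
      ring
    simp only [e, ← Finset.mul_sum]
    rw [show ((m + 1 : ℕ) : ℤ) + k = m + (k + 1 : ℕ) by push_cast; ring]
    simp only [Nat.cast_zero, add_zero, pow_zero, one_mul, Nat.add_sub_cancel, Nat.sub_zero]
    ring

theorem trBraid_t_t₁ (h : IsMarkovTrace z s tr) (p : ℤ) (k : ℕ) :
    trBraid tr (t₀ ^ p * t₁ ^ k) = algebraMap Rq A qv ^ k * s k * s p +
      (algebraMap Rq A qv - 1) * ∑ j ∈ Finset.range k, algebraMap Rq A qv ^ j *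
        trBraid tr (t₀ ^ (p + 1 + j) * t₁ ^ (k - 1 - j) * g₁) := by
  simpa using h.trBraid_conj k p 0

theorem trBraid_g_eq (h : IsMarkovTrace z s tr) (k : ℕ) : ∀ p : ℤ,
    trBraid tr (t₀ ^ p * t₁ ^ k * g₁) = algebraMap Rq A qv ^ k * z * s (p + k) +
      ∑ j ∈ Finset.range k, algebraMap Rq A qv ^ j * (algebraMap Rq A qv - 1) *
        trBraid tr (t₀ ^ (p + j) * t₁ ^ (k - j)) := by
  induction k with
  | zero => intro p; simpa using h.trBraid_t_g p
  | succ k ih =>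
    intro p
    rw [h.trBraid_g_succ, ih, Finset.sum_range_succ', mul_add, Finset.mul_sum]
    have e : ∀ j : ℕ, algebraMap Rq A qv ^ (j + 1) * (algebraMap Rq A qv - 1) *
        trBraid tr (t₀ ^ (p + (j + 1 : ℕ)) * t₁ ^ (k + 1 - (j + 1))) =
        algebraMap Rq A qv * (algebraMap Rq A qv ^ j * (algebraMap Rq A qv - 1) *
          trBraid tr (t₀ ^ (p + 1 + j) * t₁ ^ (k - j))) := by
      intro j
      rw [show p + ((j + 1 : ℕ) : ℤ) = p + 1 + j by push_cast; ring,
        show k + 1 - (j + 1) = k - j by omega, pow_succ]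
      ring
    simp only [e]
    rw [show p + ((k + 1 : ℕ) : ℤ) = p + 1 + k by push_cast; ring]
    simp only [Nat.cast_zero, add_zero, pow_zero, one_mul, Nat.sub_zero]
    ring

theorem trBraid_g_recurrence (h : IsMarkovTrace z s tr) (p : ℤ) (k : ℕ) :
    trBraid tr (t₀ ^ p * t₁ ^ (k + 1) * g₁) =
      (algebraMap Rq A qv ^ 2 - algebraMap Rq A qv + 1) *
          trBraid tr (t₀ ^ (p + 1) * t₁ ^ k * g₁) +
        algebraMap Rq A qv ^ (k + 1) * (algebraMap Rq A qv - 1) * s (k + 1 : ℕ) * s p +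
        ∑ j ∈ Finset.Icc 2 (k + 1), algebraMap Rq A qv ^ (j - 1) *
          (algebraMap Rq A qv - 1) ^ 2 *
            trBraid tr (t₀ ^ (p + j) * t₁ ^ (k + 1 - j) * g₁) := by
  have e : Finset.Icc 2 (k + 1) = Finset.Ico 2 (k + 2) := by ext; simp; omega
  -- The split-off term j = 0 is a multiple of G(p+1,k); it accounts for the coefficient q + (q-1)^2
  -- = q^2 - q + 1.
  rw [h.trBraid_g_succ, h.trBraid_t_t₁, Finset.sum_range_succ', e,
    Finset.sum_Ico_eq_sum_range, Nat.add_sub_cancel]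
  have e₂ : ∀ j : ℕ, algebraMap Rq A qv ^ (2 + j - 1) * (algebraMap Rq A qv - 1) ^ 2 *
        trBraid tr (t₀ ^ (p + (2 + j : ℕ)) * t₁ ^ (k + 1 - (2 + j)) * g₁) =
      (algebraMap Rq A qv - 1) ^ 2 * (algebraMap Rq A qv ^ (j + 1) *
        trBraid tr (t₀ ^ (p + 1 + (j + 1 : ℕ)) * t₁ ^ (k + 1 - 1 - (j + 1)) * g₁)) := by
    intro j
    rw [show p + 1 + ((j + 1 : ℕ) : ℤ) = p + (2 + j : ℕ) by push_cast; ring,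
      show k + 1 - (2 + j) = k + 1 - 1 - (j + 1) by omega, show 2 + j - 1 = j + 1 by omega]
    ring
  simp only [e₂, ← Finset.mul_sum]
  simp only [Nat.cast_zero, add_zero, pow_zero, one_mul, Nat.add_sub_cancel, Nat.sub_zero]
  ring

end IsMarkovTrace

/-! ### Universal coefficients. -/

/-- The coefficients, as polynomials in `q = X 0` and `z = X 1`, of `s_{p+k-j} s_j` in
`tr(t^p t_1^k g_1)` and in `∑_{j<k} q^j tr(t^{p+1+j} t_1^{k-1-j} g_1)`. -/
noncomputable def coeffPair : ℕ → (ℕ → MvPolynomial (Fin 2) ℤ) × (ℕ → MvPolynomial (Fin 2) ℤ)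
  | 0 => (fun j => if j = 0 then MvPolynomial.X 1 else 0, fun _ => 0)
  | k + 1 =>
    (fun j => MvPolynomial.X 0 * (coeffPair k).1 j + (MvPolynomial.X 0 - 1) *
        ((MvPolynomial.X 0 - 1) * ((coeffPair k).1 j + MvPolynomial.X 0 * (coeffPair k).2 j) +
          if j = k + 1 then MvPolynomial.X 0 ^ (k + 1) else 0),
      fun j => (coeffPair k).1 j + MvPolynomial.X 0 * (coeffPair k).2 j)

theorem coeffPair_eq_zero (k : ℕ) : ∀ j, k < j → (coeffPair k).1 j = 0 ∧ (coeffPair k).2 j = 0 := by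
  induction k with
  | zero => intro j hj; simp [coeffPair, hj.ne']
  | succ k ih =>
    intro j hj
    obtain ⟨h₁, h₂⟩ := ih j (by omega)
    simp [coeffPair, h₁, h₂, hj.ne']

/-- The coefficient of `s_{p+k-j} s_j` in `tr(t^p t_1^k)`. -/
noncomputable def coeffE (k j : ℕ) : MvPolynomial (Fin 2) ℤ :=
  (MvPolynomial.X 0 - 1) * (coeffPair k).2 j + if j = k then MvPolynomial.X 0 ^ k else 0

/-- The quadratic form in the `s_i` with coefficients `c`. -/
noncomputable def quadForm {A : Type*} [CommRing A] (q z : A) (s : ℤ → A) (c : ℕ → MvPolynomial (Fin 2) ℤ) (k : ℕ) (p : ℤ) : A :=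
  ∑ j ∈ Finset.range (k + 1), MvPolynomial.aeval ![q, z] (c j) * s (p + k - j) * s j

/-- The index p + k - j depends only on p + k, so once the top coefficient vanishes a shift in k is
a shift in p. -/
theorem quadForm_succ {A : Type*} [CommRing A] (q z : A) (s : ℤ → A) (c : ℕ → MvPolynomial (Fin 2) ℤ) (k : ℕ) (p : ℤ)
    (hc : c (k + 1) = 0) : quadForm q z s c (k + 1) p = quadForm q z s c k (p + 1) := by
  rw [quadForm, Finset.sum_range_succ, hc, quadForm]
  simp only [map_zero, zero_mul, add_zero]
  refine Finset.sum_congr rfl fun j _ => ?_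
  rw [show p + ((k + 1 : ℕ) : ℤ) - j = p + 1 + k - j by push_cast; ring]

theorem quadForm_coeffE {A : Type*} [CommRing A] (q z : A) (s : ℤ → A) (k : ℕ) (p : ℤ) :
    quadForm q z s (coeffE k) k p =
      q ^ k * s k * s p + (q - 1) * quadForm q z s (coeffPair k).2 k p := by
  simp only [quadForm, coeffE, map_add, map_mul, map_sub, map_one, MvPolynomial.aeval_X,
    Matrix.cons_val_zero, add_mul, Finset.sum_add_distrib, Finset.mul_sum]
  rw [add_comm]
  congr 1
  · rw [Finset.sum_eq_single_of_mem k (by simp)]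
    · simp only [if_true, map_pow, MvPolynomial.aeval_X, Matrix.cons_val_zero, add_sub_cancel_right]
      ring
    · intro j _ hj
      simp [hj]
  · exact Finset.sum_congr rfl fun j _ => by ring

namespace IsMarkovTrace

variable {A : Type*} [CommRing A] [Algebra Rq A] {z : A} {s : ℤ → A}
  {tr : (n : ℕ) → Hecke n →ₗ[Rq] A}

/-- Both halves must be proved together: the sum S(p,k) satisfies S(p,k+1) = G(p+1,k) + q S(p+1,k),
while G(p,k+1) needs E(p,k+1), hence S(p,k+1). The case k = 0 uses s_0 = 1. -/
theorem quadForm_coeffPair (h : IsMarkovTrace z s tr) (k : ℕ) : ∀ p : ℤ,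
    trBraid tr (t₀ ^ p * t₁ ^ k * g₁) =
        quadForm (algebraMap Rq A qv) z s (coeffPair k).1 k p ∧
      ∑ j ∈ Finset.range k, algebraMap Rq A qv ^ j *
          trBraid tr (t₀ ^ (p + 1 + j) * t₁ ^ (k - 1 - j) * g₁) =
        quadForm (algebraMap Rq A qv) z s (coeffPair k).2 k p := by
  induction k with
  | zero =>
    intro p
    have := h.trBraid_t_g p
    simp [quadForm, coeffPair, h.s_zero, this]
  | succ k ih =>
    intro p
    obtain ⟨ih₁, ih₂⟩ := ih (p + 1)
    obtain ⟨hz₁, hz₂⟩ := coeffPair_eq_zero k (k + 1) k.lt_succ_self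
    have hS : ∑ j ∈ Finset.range (k + 1), algebraMap Rq A qv ^ j *
          trBraid tr (t₀ ^ (p + 1 + j) * t₁ ^ (k + 1 - 1 - j) * g₁) =
        quadForm (algebraMap Rq A qv) z s (coeffPair (k + 1)).2 (k + 1) p := by
      have e : quadForm (algebraMap Rq A qv) z s (coeffPair (k + 1)).2 (k + 1) p =
          quadForm (algebraMap Rq A qv) z s (coeffPair k).1 (k + 1) p +
            algebraMap Rq A qv * quadForm (algebraMap Rq A qv) z s (coeffPair k).2 (k + 1) p := by
        simp only [quadForm, coeffPair, Finset.mul_sum, ← Finset.sum_add_distrib]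
        refine Finset.sum_congr rfl fun j _ => ?_
        simp only [map_add, map_mul, MvPolynomial.aeval_X, Matrix.cons_val_zero]
        ring
      rw [e, quadForm_succ _ _ _ _ _ _ hz₁, quadForm_succ _ _ _ _ _ _ hz₂, ← ih₁, ← ih₂,
        Finset.sum_range_succ', Finset.mul_sum, add_comm]
      congr 1
      · simp
      · refine Finset.sum_congr rfl fun j _ => ?_
        rw [show p + 1 + ((j + 1 : ℕ) : ℤ) = p + 1 + 1 + j by push_cast; ring,
          show k + 1 - 1 - (j + 1) = k - 1 - j by omega, pow_succ]
        ring
    refine ⟨?_, hS⟩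
    have e : quadForm (algebraMap Rq A qv) z s (coeffPair (k + 1)).1 (k + 1) p =
        algebraMap Rq A qv * quadForm (algebraMap Rq A qv) z s (coeffPair k).1 (k + 1) p +
          (algebraMap Rq A qv - 1) *
            quadForm (algebraMap Rq A qv) z s (coeffE (k + 1)) (k + 1) p := by
      simp only [quadForm, Finset.mul_sum, ← Finset.sum_add_distrib]
      refine Finset.sum_congr rfl fun j _ => ?_
      -- The bracket in the recursion for `coeffPair` is `coeffE (k + 1) j` unfolded, so `rfl`
      -- suffices.
      have : (coeffPair (k + 1)).1 j = MvPolynomial.X 0 * (coeffPair k).1 j +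
          (MvPolynomial.X 0 - 1) * coeffE (k + 1) j := rfl
      simp only [this, map_add, map_mul, map_sub, map_one, MvPolynomial.aeval_X,
        Matrix.cons_val_zero]
      ring
    rw [e, quadForm_succ _ _ _ _ _ _ hz₁, ← ih₁, quadForm_coeffE, ← hS, ← h.trBraid_t_t₁]
    exact h.trBraid_g_succ p k

end IsMarkovTrace

end TypeB

/-! ### The four families of relations. -/

theorem mainTheorem6 :
    -- the coefficients in the fourth family are integer polynomials in two variables that
    -- depend on `k` and `j` only
    ∃ f : ℕ → ℕ → MvPolynomial (Fin 2) ℤ,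
      ∀ (A : Type*) [CommRing A] [Algebra TypeB.Rq A] (z : A) (s : ℤ → A)
        (tr : (n : ℕ) → TypeB.Hecke n →ₗ[TypeB.Rq] A), TypeB.IsMarkovTrace z s tr →
      ∀ q : A, q = algebraMap TypeB.Rq A TypeB.qv →
      ∀ p : ℤ,
        (∀ k : ℕ,
          TypeB.trBraid tr (TypeB.t₀ ^ p * TypeB.t₁ ^ k * TypeB.g₁) =
            q ^ k * z * s (p + k) +
              ∑ j ∈ Finset.range k, q ^ j * (q - 1) *
                TypeB.trBraid tr (TypeB.t₀ ^ (p + j) * TypeB.t₁ ^ (k - j))) ∧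
        (∀ k : ℕ, 1 ≤ k →
          TypeB.trBraid tr (TypeB.t₀ ^ p * TypeB.t₁ ^ k * TypeB.g₁⁻¹) =
            q ^ (k - 1) * z * s (p + k) +
              ∑ j ∈ Finset.range (k - 1), q ^ j * (q - 1) *
                TypeB.trBraid tr (TypeB.t₀ ^ (p + 1 + j) * TypeB.t₁ ^ (k - 1 - j))) ∧
        (∀ k : ℕ, 1 ≤ k →
          TypeB.trBraid tr (TypeB.t₀ ^ p * TypeB.t₁ ^ k * TypeB.g₁) =
            (q ^ 2 - q + 1) * TypeB.trBraid tr (TypeB.t₀ ^ (p + 1) * TypeB.t₁ ^ (k - 1) * TypeB.g₁) +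
              q ^ k * (q - 1) * s k * s p +
              ∑ j ∈ Finset.Icc 2 k, q ^ (j - 1) * (q - 1) ^ 2 *
                TypeB.trBraid tr (TypeB.t₀ ^ (p + j) * TypeB.t₁ ^ (k - j) * TypeB.g₁)) ∧
        (∀ k : ℕ,
          TypeB.trBraid tr (TypeB.t₀ ^ p * TypeB.t₁ ^ k) =
            ∑ j ∈ Finset.range (k + 1),
              MvPolynomial.aeval ![q, z] (f k j) * s (p + k - j) * s j) := by
  refine ⟨TypeB.coeffE, ?_⟩
  rintro A _ _ z s tr h q rfl p
  refine ⟨fun k => h.trBraid_g_eq k p, ?_, ?_, ?_⟩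
  · rintro (_ | k) hk
    · omega
    · rw [h.trBraid_inv_g, h.trBraid_g_eq]
      rw [show p + ((k + 1 : ℕ) : ℤ) = p + 1 + k by push_cast; ring]
      rfl
  · rintro (_ | k) hk
    · omega
    · exact h.trBraid_g_recurrence p k
  · intro k
    rw [h.trBraid_t_t₁, (h.quadForm_coeffPair k p).2]
    exact (TypeB.quadForm_coeffE _ _ _ _ _).symm
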